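/- **Conventions.** Let $N\ge 1$. The free complex sphere $S^{N-1}_{\mathbb C,+}$ is the noncommutative space with $C(S^{N-1}_{\mathbb C,+})=C^*(x_1,\dots,x_N\mid\sum_i x_ix_i^*=\sum_i x_i^*x_i=1)$. A closed subspace $X\subset S^{N-1}_{\mathbb C,+}$ is a quotient C*-algebra $C(X)$ of this algebra, and $X\subset Y$ means that there is a *-homomorphism $C(Y)\to C(X)$ with $x_i\mapsto x_i$; $X$ is an algebraic manifold if $C(X)$ is obtained by imposing relations between *-polynomials in the $x_i$. A closed quantum subgroup $G\subset U_N^+$ is a C*-algebra $C(G)\neq 0$ generated by the entries of a matrix $u=(u_{ij})$ with $u^*=u^{-1}$, $u^t=\bar u^{-1}$, having a morphism $\Delta:C(G)\to C(G)\otimes C(G)$, $\Delta(u_{ij})=\sum_k u_{ik}\otimes u_{kj}$; full and reduced versions of such algebras are identified, and $\int_G$ is the Haar state. An affine action $G\curvearrowright X$ is a morphism $\Phi:C(X)\to C(G)\otimes C(X)$ with $\Phi(x_i)=\sum_j u_{ij}\otimes x_j$, and $G^+(X)$ is the biggest quantum subgroup of $U_N^+$ acting affinely on $X$. The quantum group $K_N^+\subset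 U_N^+$ is defined by the condition that $u_{ij}u_{ij}^*=u_{ij}^*u_{ij}$ are projections summing up to $1$ on each row and column, and $H_N=\mathbb Z_2\wr S_N$. The standard torus of $S$ is given by $C(T)=C(S)/\langle x_ix_i^*=x_i^*x_i=\frac1N\rangle$, and is a subspace of the dual $\widehat{F_N}$ of the free group via $g_i=\sqrt N x_i$; the diagonal torus of $G$ is given by $C(T)=C(G)/\langle u_{ij}=0,\ i\ne j\rangle$, with $g_i=u_{ii}$. A *noncommutative geometry* $(S,T,K,G)$ consists of an algebraic manifold $S^{N-1}_{\mathbb R}\subset S\subset S^{N-1}_{\mathbb C,+}$, a compact noncommutative space $\mathbb Z_2^N\subset T\subset\widehat{F_N}$, and quantum groups $H_N\subset K\subset K_N^+$, $O_N\subset G\subset U_N^+$, such that $K=G\cap K_N^+$; $G=\langle K,O_N\rangle$ (that is, $\mathrm{Hom}_G(u^{\otimes k},u^{\otimes l})=\mathrm{Hom}_K(u^{\otimes k},u^{\otimes l})\cap \mathrm{Hom}_{O_N}(u^{\otimes k},u^{\otimes l})$ for all colored integers $k,l$); $T$ is the standard torus of $S$ and the diagonal torus of both $K$ and $G$; $G=G^+(S)$;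 and $K=G\cap G^+(T)$. It is *ergodic* if $$\Big(\int_G\otimes\, id\Big)\Phi(f)=\Big(\int_G\alpha(f)\Big)1\qquad\text{for all } f\in C(S),$$ where $\Phi:C(S)\to C(G)\otimes C(S)$ is the affine action and $\alpha:C(S)\to C(G)$ is the canonical morphism, $\alpha(x_i)=u_{i1}$. **Theorem.** Let $(S,T,K,G)$ be an ergodic noncommutative geometry. Then there are inclusions of subspaces of $S^{N-1}_{\mathbb C,+}$ $$S_{min}\subset S\subset S_{max},$$ where $C(S_{min})\subset C(G)$ is the C*-subalgebra generated by the first column entries $x_i=u_{i1}$, and where $S_{max}$ is obtained from $S^{N-1}_{\mathbb C,+}$ by imposing the relations $$\sum_{j_1\ldots j_p}\int_G u_{i_1j_1}^{e_1}\cdots u_{i_pj_p}^{e_p}\cdot x_{j_1}^{e_1}\cdots x_{j_p}^{e_p}=\int_G u_{i_11}^{e_1}\cdots u_{i_p1}^{e_p}\cdot 1$$ for all $p\ge 0$, all indices $i_1,\dots,i_p\in\{1,\dots,N\}$ and all exponents $e_1,\dots,e_p\in\{1,*\}$. -/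

import Mathlib

open scoped TensorProduct ENNReal ComplexOrder

universe u

noncomputable section

namespace NCG

/-! ### Noncommutative *-polynomials -/

/-- Colored exponent: `colored false a = a` and `colored true a = a*`. -/
def colored {A : Type*} [Star A] (e : Bool) (a : A) : A := if e then star a else a

/-- The free complex *-algebra on `ι`, i.e. noncommutative polynomials in variables
`x_i = (i, false)` and their formal adjoints `x_i* = (i, true)`. -/
abbrev StarPoly (ι : Type) : Type := FreeAlgebra ℂ (ι × Bool)

namespace StarPoly

variable {ι : Type}

/-- The value `f(x)` of a *-polynomial at a family `x` of elements of a *-algebra. -/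
def eval {A : Type*} [Ring A] [Algebra ℂ A] [Star A] (x : ι → A) : StarPoly ι →ₐ[ℂ] A :=
  FreeAlgebra.lift ℂ fun p => colored p.2 (x p.1)

lemma map_eval {A B : Type*} [Ring A] [Algebra ℂ A] [Star A] [Ring B] [Algebra ℂ B] [Star B]
    (φ : A →⋆ₐ[ℂ] B) (x : ι → A) (f : StarPoly ι) : φ (eval x f) = eval (fun i => φ (x i)) f := by
  have : (φ : A →ₐ[ℂ] B).comp (eval x) = eval (fun i => φ (x i)) := by
    apply FreeAlgebra.hom_ext
    funext p
    simp only [Function.comp_apply, AlgHom.comp_apply, eval, FreeAlgebra.lift_ι_apply, colored]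
    split
    · exact map_star φ (x p.1)
    · rfl
  exact DFunLike.congr_fun this f

lemma mem_adjoin_iff {A : Type*} [Ring A] [Algebra ℂ A] [StarRing A] [StarModule ℂ A]
    (x : ι → A) (a : A) :
    a ∈ StarAlgebra.adjoin ℂ (Set.range x) ↔ ∃ f, eval x f = a := by
  rw [← StarSubalgebra.mem_toSubalgebra, StarAlgebra.adjoin_toSubalgebra]
  have : (eval x).range = Algebra.adjoin ℂ (Set.range x ∪ star (Set.range x)) := by
    rw [eval, ← Algebra.adjoin_range_eq_range_freeAlgebra_lift]
    congr 1
    ext a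
    simp only [Set.mem_range, Prod.exists, Bool.exists_bool, colored, Set.mem_union, Set.mem_star]
    constructor
    · rintro ⟨i, h | h⟩
      · exact Or.inl ⟨i, by simpa using h⟩
      · exact Or.inr ⟨i, by simp at h; simp [← h]⟩
    · rintro (⟨i, h⟩ | ⟨i, h⟩)
      · exact ⟨i, Or.inl (by simpa using h)⟩
      · exact ⟨i, Or.inr (by simp [h])⟩
  rw [← this]
  rfl

/-- The monomial `x_{i_1}^{e_1} ⋯ x_{i_p}^{e_p}`. -/
def word {p : ℕ} (i : Fin p → ι) (e : Fin p → Bool) : StarPoly ι :=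
  (List.ofFn fun k => FreeAlgebra.ι ℂ (i k, e k)).prod

/-- All the *-polynomial relations satisfied by the family `x`: the kernel of evaluation at `x`.
The *-algebra generated by the `x_i` is the free *-algebra modulo this ideal. -/
def relations {A : Type*} [Ring A] [Algebra ℂ A] [Star A] (x : ι → A) : Set (StarPoly ι) :=
  {f | eval x f = 0}

/-- The *-polynomial relations holding among the generators of the universal C*-algebra on
generators indexed by `ι` subject to the conditions `P`: those which hold for every family, in any
C*-algebra, which satisfies `P`. -/
def universalRelations (P : ∀ (B : Type u) [CStarAlgebra B], (ι → B) → Prop) :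
    Set (StarPoly ι) :=
  {f | ∀ (B : Type u) [CStarAlgebra B] (y : ι → B), P B y → eval y f = 0}

end StarPoly

/-! ### Noncommutative subspaces of the free complex sphere -/

/-- The relations `∑ xᵢ xᵢ* = ∑ xᵢ* xᵢ = 1`. -/
def IsSphere {N : ℕ} {A : Type*} [Ring A] [Star A] (x : Fin N → A) : Prop :=
  ∑ i, x i * star (x i) = 1 ∧ ∑ i, star (x i) * x i = 1

/-- A closed noncommutative subspace `X` of the free complex sphere `S^{N-1}_{ℂ,+}`: a C*-algebra
`C(X)` together with generators (the standard coordinates) subject to the sphere relations,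
equivalently a quotient of `C(S^{N-1}_{ℂ,+})`. -/
structure SphereSubspace (N : ℕ) : Type (u + 1) where
  /-- The algebra `C(X)`. -/
  carrier : Type u
  [cstar : CStarAlgebra carrier]
  /-- The standard coordinates. -/
  x : Fin N → carrier
  sphere : IsSphere x
  dense : (StarAlgebra.adjoin ℂ (Set.range x)).topologicalClosure = ⊤

attribute [instance] SphereSubspace.cstar

/-- Inclusion `X ⊂ Y` of noncommutative spaces, where `X` has coordinates `x i ∈ C(X)` and `Y` has
coordinates `y i ∈ C(Y)`: there is a *-homomorphism `C(Y) → C(X)`, mapping `y i` to `x i`. -/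
def CoordIncl {ι A B : Type*} [Ring A] [Algebra ℂ A] [Star A] [Ring B] [Algebra ℂ B] [Star B]
    (x : ι → A) (y : ι → B) : Prop :=
  ∃ φ : B →⋆ₐ[ℂ] A, ∀ i, φ (y i) = x i

/-- Inclusion of subspaces of the free complex sphere. -/
instance {N : ℕ} : LE (SphereSubspace.{u} N) := ⟨fun X Y => CoordIncl X.x Y.x⟩

namespace SphereSubspace

variable {N : ℕ}

lemma norm_le_one {A : Type*} [CStarAlgebra A] {x : Fin N → A}
    (h : IsSphere x) (i : Fin N) : ‖x i‖ ≤ 1 := by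
  let _ := CStarAlgebra.spectralOrder A
  have := CStarAlgebra.spectralOrderedRing A
  have h1 : star (x i) * x i ≤ 1 := by
    rw [← h.2]
    exact Finset.single_le_sum (f := fun i => star (x i) * x i)
      (fun j _ => star_mul_self_nonneg (x j)) (Finset.mem_univ i)
  have h2 : ‖star (x i) * x i‖ ≤ 1 :=
    (CStarAlgebra.norm_le_one_iff_of_nonneg _ (star_mul_self_nonneg _)).2 h1
  rw [CStarRing.norm_star_mul_self] at h2
  nlinarith [norm_nonneg (x i)]

/-- The subspace whose algebra of functions is the C*-subalgebra of `A` generated by given elements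
`x i` of `A` satisfying the sphere relations. -/
def generated {A : Type u} [CStarAlgebra A] (x : Fin N → A) (h : IsSphere x) :
    SphereSubspace.{u} N :=
  letI B := (StarAlgebra.adjoin ℂ (Set.range x)).topologicalClosure
  haveI hB : IsClosed (B : Set A) := StarSubalgebra.isClosed_topologicalClosure _
  { carrier := B
    cstar := StarSubalgebra.cstarAlgebra B
    x := fun i => ⟨x i, StarSubalgebra.le_topologicalClosure _
      (StarAlgebra.subset_adjoin ℂ _ ⟨i, rfl⟩)⟩
    sphere := by
      constructor
      · apply Subtype.ext
        simpa using h.1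
      · apply Subtype.ext
        simpa using h.2
    dense := by
      rw [eq_top_iff]
      rintro ⟨b, hb⟩ -
      rw [← SetLike.mem_coe, StarSubalgebra.topologicalClosure_coe,
        Topology.IsInducing.subtypeVal.closure_eq_preimage_closure_image]
      change b ∈ closure _
      change b ∈ ((StarAlgebra.adjoin ℂ (Set.range x)).topologicalClosure : Set A) at hb
      rw [StarSubalgebra.topologicalClosure_coe] at hb
      refine closure_mono ?_ hb
      intro a ha
      obtain ⟨f, rfl⟩ := (StarPoly.mem_adjoin_iff x a).1 ha
      refine ⟨_, (StarPoly.mem_adjoin_iff _ _).2 ⟨f, rfl⟩, ?_⟩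
      exact StarPoly.map_eval (StarSubalgebra.subtype B) _ f }

/-- The norms `f ↦ ‖f(x)‖` on *-polynomials coming from the (nonempty) subspaces of the free complex
sphere whose coordinates satisfy the relations `f(x) = 0`, `f ∈ R`. -/
def seminorms (R : Set (StarPoly (Fin N))) : Set (StarPoly (Fin N) → ℝ) :=
  {p | ∃ X : SphereSubspace.{u} N, Nontrivial X.carrier ∧ R ⊆ StarPoly.relations X.x ∧
    p = fun f => ‖StarPoly.eval X.x f‖}

/-- A subspace of the sphere inducing a given norm on the *-polynomials. -/
def ofSeminorm {R : Set (StarPoly (Fin N))} (p : seminorms.{u} R) : SphereSubspace.{u} N :=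
  p.2.choose

instance {R : Set (StarPoly (Fin N))} (p : seminorms.{u} R) : Nontrivial (ofSeminorm p).carrier :=
  p.2.choose_spec.1

/-- The ambient C*-algebra of the universal representation of the relations `R`. -/
abbrev BigAlgebra (R : Set (StarPoly (Fin N))) : Type u :=
  lp (fun p : seminorms.{u} R => (ofSeminorm p).carrier) ∞

instance (R : Set (StarPoly (Fin N))) : CStarAlgebra (BigAlgebra.{u} R) where

/-- The coordinates of the universal representation of the relations `R`. -/
def bigCoord (R : Set (StarPoly (Fin N))) (i : Fin N) : BigAlgebra.{u} R :=
  ⟨fun p => (ofSeminorm p).x i, memℓp_infty ⟨1, by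
    rintro _ ⟨p, rfl⟩
    exact norm_le_one (ofSeminorm p).sphere i⟩⟩

lemma isSphere_bigCoord (R : Set (StarPoly (Fin N))) : IsSphere (bigCoord.{u} R) := by
  constructor
  · apply lp.ext
    funext p
    have h := (ofSeminorm p).sphere.1
    simp only [lp.coeFn_sum, Finset.sum_apply]
    exact h
  · apply lp.ext
    funext p
    have h := (ofSeminorm p).sphere.2
    simp only [lp.coeFn_sum, Finset.sum_apply]
    exact h

/-- The projection of the ambient algebra onto a factor. -/
def bigProj {R : Set (StarPoly (Fin N))} (p : seminorms.{u} R) :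
    BigAlgebra.{u} R →⋆ₐ[ℂ] (ofSeminorm p).carrier where
  toFun a := a p
  map_one' := rfl
  map_mul' _ _ := rfl
  map_zero' := rfl
  map_add' _ _ := rfl
  commutes' _ := rfl
  map_star' _ := rfl

lemma eval_bigCoord (R : Set (StarPoly (Fin N))) (f : StarPoly (Fin N)) (p : seminorms.{u} R) :
    StarPoly.eval (bigCoord R) f p = StarPoly.eval (ofSeminorm p).x f :=
  StarPoly.map_eval (bigProj p) (bigCoord R) f

/-- The subspace obtained from the free complex sphere by imposing the relations `f(x) = 0`, `f ∈ R`
on the coordinates. Its algebra is the universal C*-algebra generated by `x_1, …, x_N` with the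
sphere relations and the relations `R` (see `exists_hom_cutOut`), built inside the product of all
representations of these relations. -/
def cutOut (R : Set (StarPoly (Fin N))) : SphereSubspace.{u} N :=
  generated (bigCoord R) (isSphere_bigCoord R)

/-- An algebraic submanifold of the free complex sphere: a closed subspace which is defined by
algebraic relations. -/
def IsAlgebraic (X : SphereSubspace.{u} N) : Prop :=
  ∃ R : Set (StarPoly (Fin N)), X ≤ cutOut R ∧ cutOut R ≤ X

lemma cutOut_relations (R : Set (StarPoly (Fin N))) :
    R ⊆ StarPoly.relations (cutOut.{u} R).x := by
  intro f hf
  apply Subtype.ext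
  apply lp.ext
  funext p
  have h1 := StarPoly.map_eval
    (StarSubalgebra.subtype (StarAlgebra.adjoin ℂ (Set.range (bigCoord.{u} R))).topologicalClosure)
    (cutOut.{u} R).x f
  have h2 := eval_bigCoord R f p
  have h3 : StarPoly.eval (ofSeminorm p).x f = 0 := by
    have h4 := p.2.choose_spec.2.1 hf
    exact h4
  exact (congrArg (fun a : BigAlgebra.{u} R => a p) h1).trans (h2.trans h3)

/-- Extension of a bounded evaluation to the C*-algebra. -/
lemma exists_hom_of_norm_le (X : SphereSubspace.{u} N) {B : Type u} [CStarAlgebra B] (y : Fin N → B)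
    (hy : IsSphere y) (hle : ∀ f, ‖StarPoly.eval y f‖ ≤ ‖StarPoly.eval X.x f‖) :
    ∃ φ : X.carrier →⋆ₐ[ℂ] B, ∀ i, φ (X.x i) = y i := by
  have hs : IsSphere (fun i => (X.x i, y i)) := by
    constructor
    · ext
      · simpa [Prod.fst_sum] using X.sphere.1
      · simpa [Prod.snd_sum] using hy.1
    · ext
      · simpa [Prod.fst_sum] using X.sphere.2
      · simpa [Prod.snd_sum] using hy.2
  let C := generated (fun i => (X.x i, y i)) hs
  let ιC : C.carrier →⋆ₐ[ℂ] X.carrier × B :=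
    StarSubalgebra.subtype (StarAlgebra.adjoin ℂ (Set.range _)).topologicalClosure
  have hι : ∀ i, ιC (C.x i) = (X.x i, y i) := fun i => rfl
  have hιc : ∀ c : C.carrier, ‖ιC c‖ = ‖c‖ := fun c => rfl
  let π₁ : C.carrier →⋆ₐ[ℂ] X.carrier := (StarAlgHom.fst ℂ X.carrier B).comp ιC
  let π₂ : C.carrier →⋆ₐ[ℂ] B := (StarAlgHom.snd ℂ X.carrier B).comp ιC
  have e₁ : ∀ f, π₁ (StarPoly.eval C.x f) = StarPoly.eval X.x f := fun f => StarPoly.map_eval π₁ _ f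
  have e₂ : ∀ f, π₂ (StarPoly.eval C.x f) = StarPoly.eval y f := fun f => StarPoly.map_eval π₂ _ f
  have hcont : Continuous π₁ := 
    AddMonoidHomClass.continuous_of_bound π₁ 1 fun c => by
      rw [one_mul]; exact NonUnitalStarAlgHom.norm_apply_le π₁ c
  have hnorm : ∀ c, ‖π₁ c‖ = ‖c‖ := by
    have hcl : IsClosed {c : C.carrier | ‖π₁ c‖ = ‖c‖} :=
      isClosed_eq hcont.norm continuous_norm
    intro c
    have hc : c ∈ (StarAlgebra.adjoin ℂ (Set.range C.x)).topologicalClosure := by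
      rw [C.dense]; trivial
    rw [← SetLike.mem_coe, StarSubalgebra.topologicalClosure_coe] at hc
    refine hcl.closure_subset_iff.2 ?_ hc
    intro a ha
    obtain ⟨f, rfl⟩ := (StarPoly.mem_adjoin_iff _ a).1 ha
    have : ‖StarPoly.eval C.x f‖ = max ‖π₁ (StarPoly.eval C.x f)‖ ‖π₂ (StarPoly.eval C.x f)‖ :=
      (hιc _).symm
    change ‖π₁ (StarPoly.eval C.x f)‖ = ‖StarPoly.eval C.x f‖
    rw [this, e₁, e₂, max_eq_left (hle f)]
  have hiso : Isometry π₁ := AddMonoidHomClass.isometry_of_norm π₁ hnorm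
  have hsurj : Function.Surjective π₁ := by
    intro a
    have ha : a ∈ (StarAlgebra.adjoin ℂ (Set.range X.x)).topologicalClosure := by
      rw [X.dense]; trivial
    rw [← SetLike.mem_coe, StarSubalgebra.topologicalClosure_coe] at ha
    refine hiso.isClosedEmbedding.isClosed_range.closure_subset_iff.2 ?_ ha
    intro b hb
    obtain ⟨f, rfl⟩ := (StarPoly.mem_adjoin_iff _ b).1 hb
    exact ⟨_, e₁ f⟩
  let E := StarAlgEquiv.ofBijective π₁ ⟨hiso.injective, hsurj⟩
  refine ⟨π₂.comp (E.symm : X.carrier →⋆ₐ[ℂ] C.carrier), fun i => ?_⟩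
  have : E.symm (X.x i) = C.x i := by
    rw [StarAlgEquiv.symm_apply_eq]
    rfl
  change π₂ (E.symm (X.x i)) = y i
  rw [this]
  rfl

lemma exists_hom_cutOut (R : Set (StarPoly (Fin N))) {B : Type u} [CStarAlgebra B] (y : Fin N → B)
    (hy : IsSphere y) (hR : R ⊆ StarPoly.relations y) :
    ∃ φ : (cutOut.{u} R).carrier →⋆ₐ[ℂ] B, ∀ i, φ ((cutOut.{u} R).x i) = y i := by
  refine exists_hom_of_norm_le _ y hy fun f => ?_
  rcases subsingleton_or_nontrivial B with hB | hB
  · rw [Subsingleton.elim (StarPoly.eval y f) 0, norm_zero]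
    exact norm_nonneg _
  let X := generated y hy
  let ιX : X.carrier →⋆ₐ[ℂ] B :=
    StarSubalgebra.subtype (StarAlgebra.adjoin ℂ (Set.range _)).topologicalClosure
  have hX : ∀ g, ιX (StarPoly.eval X.x g) = StarPoly.eval y g :=
    fun g => StarPoly.map_eval ιX X.x g
  have hXn : ∀ g, ‖StarPoly.eval X.x g‖ = ‖StarPoly.eval y g‖ := fun g => by
    rw [← hX g]; rfl
  let p : seminorms.{u} R := ⟨fun g => ‖StarPoly.eval X.x g‖, X, ιX.toRingHom.domain_nontrivial,
    fun g hg => norm_eq_zero.1 (by rw [hXn, show StarPoly.eval y g = 0 from hR hg, norm_zero]), rfl⟩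
  have hp : ‖StarPoly.eval X.x f‖ = ‖StarPoly.eval (ofSeminorm p).x f‖ :=
    congrFun p.2.choose_spec.2.2 f
  rw [← hXn, hp, ← eval_bigCoord R f p]
  refine (lp.norm_apply_le_norm ENNReal.top_ne_zero _ p).trans (le_of_eq ?_)
  exact congrArg norm (StarPoly.map_eval
    (StarSubalgebra.subtype (StarAlgebra.adjoin ℂ (Set.range (bigCoord.{u} R))).topologicalClosure)
    (cutOut.{u} R).x f).symm

end SphereSubspace
/-! ### C*-tensor products -/

/-- A C*-algebra tensor product of `A` and `B`: a C*-algebra in which the algebraic tensor product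
sits as a dense *-subalgebra. (There may be several such completions; each of them has the minimal
one as a quotient, so that "there is a morphism with given values on generators into some C*-tensor
product" is the same as "... into the minimal C*-tensor product".) -/
structure CStarTensor (A B : Type u) [CStarAlgebra A] [CStarAlgebra B] : Type (u + 1) where
  carrier : Type u
  [cstar : CStarAlgebra carrier]
  /-- The inclusion of the algebraic tensor product. -/
  incl : A ⊗[ℂ] B →⋆ₐ[ℂ] carrier
  injective : Function.Injective incl
  denseRange : DenseRange incl

attribute [instance] CStarTensor.cstar

namespace CStarTensor

variable {A B : Type u} [CStarAlgebra A] [CStarAlgebra B]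

/-- `L` is the slice map `φ ⊗ id : A ⊗ B → B`. -/
def IsLeftSlice (T : CStarTensor A B) (φ : A →L[ℂ] ℂ) (L : T.carrier →L[ℂ] B) : Prop :=
  ∀ a b, L (T.incl (a ⊗ₜ b)) = φ a • b

/-- `L` is the slice map `id ⊗ φ : A ⊗ B → A`. -/
def IsRightSlice (T : CStarTensor A B) (φ : B →L[ℂ] ℂ) (L : T.carrier →L[ℂ] A) : Prop :=
  ∀ a b, L (T.incl (a ⊗ₜ b)) = φ b • a

end CStarTensor

/-! ### Quantum subgroups of the free unitary group -/

/-- `u` and its entrywise adjoint `ū` satisfy `u* = u⁻¹` and `uᵗ = ū⁻¹`. -/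
def IsBiunitary {N : ℕ} {A : Type*} [Ring A] [StarRing A] (u : Matrix (Fin N) (Fin N) A) : Prop :=
  (u.conjTranspose * u = 1 ∧ u * u.conjTranspose = 1) ∧
    (u.transpose * u.map star = 1 ∧ u.map star * u.transpose = 1)

/-- A closed quantum subgroup `G ⊂ U_N^+`: a nonzero C*-algebra `C(G)` generated by the entries of a
biunitary matrix `u`, with a comultiplication `Δ(u_ij) = ∑ₖ u_ik ⊗ u_kj`. Any version of the algebra
(full, reduced, or in between) is allowed. -/
structure QuantumSubgroup (N : ℕ) : Type (u + 1) where
  /-- The algebra `C(G)`. -/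
  carrier : Type u
  [cstar : CStarAlgebra carrier]
  [nontrivial : Nontrivial carrier]
  /-- The fundamental corepresentation. -/
  u : Matrix (Fin N) (Fin N) carrier
  biunitary : IsBiunitary u
  dense : (StarAlgebra.adjoin ℂ
    (Set.range fun p : Fin N × Fin N => u p.1 p.2)).topologicalClosure = ⊤
  /-- The tensor product `C(G) ⊗ C(G)`. -/
  tensor : CStarTensor carrier carrier
  /-- The comultiplication. -/
  Δ : carrier →⋆ₐ[ℂ] tensor.carrier
  Δ_apply : ∀ i j, Δ (u i j) = tensor.incl (∑ k, u i k ⊗ₜ u k j)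

attribute [instance] QuantumSubgroup.cstar QuantumSubgroup.nontrivial

/-- The family of entries of a matrix. -/
def entries {N : ℕ} {A : Type*} (u : Matrix (Fin N) (Fin N) A) (p : Fin N × Fin N) : A := u p.1 p.2

/-- The entry `u_{i_1 j_1}^{e_1} ⋯ u_{i_p j_p}^{e_p}` of the tensor power `u^{⊗ e}`, where `e` is a
colored integer of length `p`, with `u^{false} = u` and `u^{true} = ū`. -/
def tensorPower {N : ℕ} {A : Type*} [Ring A] [Star A] (u : Matrix (Fin N) (Fin N) A) {p : ℕ}
    (e : Fin p → Bool) : Matrix (Fin p → Fin N) (Fin p → Fin N) A :=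
  Matrix.of fun i j => (List.ofFn fun k => colored (e k) (u (i k) (j k))).prod

/-- The Tannakian space `Hom(u^{⊗ k}, u^{⊗ l})`. -/
def homSpace {N : ℕ} {A : Type*} [Ring A] [Algebra ℂ A] [Star A] (u : Matrix (Fin N) (Fin N) A)
    {p q : ℕ} (k : Fin p → Bool) (l : Fin q → Bool) :
    Set (Matrix (Fin q → Fin N) (Fin p → Fin N) ℂ) :=
  {t | t.map (algebraMap ℂ A) * tensorPower u k = tensorPower u l * t.map (algebraMap ℂ A)}

/-- The relations defining `C(K_N^+)`: the matrix `v` is biunitary, and `v_ij v_ij* = v_ij* v_ij` are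
projections summing up to `1` on each row and each column. -/
def IsReflectionMatrix {N : ℕ} {A : Type*} [Ring A] [StarRing A] (v : Matrix (Fin N) (Fin N) A) :
    Prop :=
  IsBiunitary v ∧ (∀ i j, v i j * star (v i j) = star (v i j) * v i j) ∧
    (∀ i j, IsStarProjection (v i j * star (v i j))) ∧
    (∀ i, ∑ j, v i j * star (v i j) = 1) ∧ (∀ j, ∑ i, v i j * star (v i j) = 1)

/-- The coordinate functions of the orthogonal group `O_N`. -/
def orthogonalCoord (N : ℕ) :
    Matrix (Fin N) (Fin N) C(Matrix.orthogonalGroup (Fin N) ℝ, ℂ) :=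
  Matrix.of fun i j => ⟨fun g => ((g : Matrix (Fin N) (Fin N) ℝ) i j : ℂ),
    Complex.continuous_ofReal.comp (continuous_subtype_val.matrix_elem i j)⟩

/-- The coordinate functions of the hyperoctahedral group `H_N = ℤ₂ ≀ S_N`, the finite group of
signed permutation matrices. -/
def hyperoctahedralCoord (N : ℕ) :
    Matrix (Fin N) (Fin N) ((Fin N → ℤˣ) × Equiv.Perm (Fin N) → ℂ) :=
  Matrix.of fun i j g => if g.2 j = i then ((g.1 i : ℤ) : ℂ) else 0

namespace QuantumSubgroup

variable {N : ℕ}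

/-- The *-polynomial relations between the coordinates `u_ij` of `G`. These determine `G` up to the
identification of full and reduced algebras. -/
def relations (G : QuantumSubgroup.{u} N) : Set (StarPoly (Fin N × Fin N)) :=
  StarPoly.relations (entries G.u)

/-- Inclusion `H ⊂ G` of quantum groups, with full and reduced algebras identified: there is a
coordinate-preserving morphism between the *-algebras generated by the coordinates. -/
instance : LE (QuantumSubgroup.{u} N) := ⟨fun H G => G.relations ⊆ H.relations⟩

/-- `K = G ∩ H`: the algebra of `K` is the quotient of `C(U_N^+)` by the relations of `G` and those
of `H` (up to the identification of full and reduced algebras). -/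
def IsInter (K G H : QuantumSubgroup.{u} N) : Prop :=
  K.relations = StarPoly.universalRelations.{u} fun _ _ v =>
    G.relations ⊆ StarPoly.relations v ∧ H.relations ⊆ StarPoly.relations v

/-- `K = G ∩ K_N^+`. -/
def IsReflectionPart (K G : QuantumSubgroup.{u} N) : Prop :=
  K.relations = StarPoly.universalRelations.{u} fun _ _ v =>
    G.relations ⊆ StarPoly.relations v ∧ IsReflectionMatrix (Matrix.of fun i j => v (i, j))

/-- `G = <K, O_N>`: the Tannakian category of `G` is the intersection of those of `K` and `O_N`. -/
def IsGeneratedByOrthogonal (G K : QuantumSubgroup.{u} N) : Prop :=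
  ∀ (p q : ℕ) (k : Fin p → Bool) (l : Fin q → Bool),
    homSpace G.u k l = homSpace K.u k l ∩ homSpace (orthogonalCoord N) k l

/-- `Φ : C(X) → C(G) ⊗ C(X)` is given by `Φ(x_i) = ∑_j u_ij ⊗ x_j`. -/
def IsCoaction (G : QuantumSubgroup.{u} N) (X : SphereSubspace.{u} N)
    (T : CStarTensor G.carrier X.carrier) (Φ : X.carrier →⋆ₐ[ℂ] T.carrier) : Prop :=
  ∀ i, Φ (X.x i) = T.incl (∑ j, G.u i j ⊗ₜ X.x j)

/-- There is an affine action of `G` on `X`. -/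
def ActsOn (G : QuantumSubgroup.{u} N) (X : SphereSubspace.{u} N) : Prop :=
  ∃ (T : CStarTensor G.carrier X.carrier) (Φ : X.carrier →⋆ₐ[ℂ] T.carrier), G.IsCoaction X T Φ

/-- `G = G^+(X)`: the affine quantum isometry group, i.e. the biggest quantum subgroup of `U_N^+`
acting affinely on `X`. -/
def IsQuantumIsometryGroup (G : QuantumSubgroup.{u} N) (X : SphereSubspace.{u} N) : Prop :=
  G.ActsOn X ∧ ∀ H : QuantumSubgroup.{u} N, H.ActsOn X → H ≤ G

/-- `T`, with rescaled coordinates `g_i = √N x_i`, is the diagonal torus of `G`: its algebra is the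
quotient of `C(G)` by the relations `u_ij = 0` for `i ≠ j`, with `g_i` corresponding to `u_ii`
(up to the identification of full and reduced algebras). -/
def IsDiagonalTorus (G : QuantumSubgroup.{u} N) (T : SphereSubspace.{u} N) : Prop :=
  StarPoly.relations (entries (Matrix.diagonal fun i => (Real.sqrt N : ℂ) • T.x i)) =
    StarPoly.universalRelations.{u} fun _ _ v =>
      G.relations ⊆ StarPoly.relations v ∧ ∀ i j, i ≠ j → v (i, j) = 0

/-- `h` is a Haar state: a state such that `(h ⊗ id)Δ = h(·)1 = (id ⊗ h)Δ`. -/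
def IsHaarState (G : QuantumSubgroup.{u} N) (h : G.carrier →L[ℂ] ℂ) : Prop :=
  h 1 = 1 ∧ (∀ a, 0 ≤ h (star a * a)) ∧
    (∃ L, G.tensor.IsLeftSlice h L ∧ ∀ a, L (G.Δ a) = h a • 1) ∧
    (∃ L, G.tensor.IsRightSlice h L ∧ ∀ a, L (G.Δ a) = h a • 1)

open Classical in
/-- The Haar integration `∫_G : C(G) → ℂ`, i.e. the Haar state of `G` (which exists and is unique, by
a theorem of Woronowicz). -/
def haar (G : QuantumSubgroup.{u} N) : G.carrier →L[ℂ] ℂ :=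
  if h : ∃ φ, G.IsHaarState φ then h.choose else 0

lemma isSphere_firstColumn [NeZero N] (G : QuantumSubgroup.{u} N) :
    IsSphere fun i => G.u i 0 := by
  constructor
  · have h := congrFun (congrFun G.biunitary.2.1 0) 0
    simpa [Matrix.mul_apply] using h
  · have h := congrFun (congrFun G.biunitary.1.1 0) 0
    simpa [Matrix.mul_apply] using h

/-- The first column space `S_min` of `G`: its algebra is the C*-subalgebra of `C(G)` generated by
the entries `x_i = u_{i1}` of the first column. -/
def firstColumnSpace [NeZero N] (G : QuantumSubgroup.{u} N) : SphereSubspace.{u} N :=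
  SphereSubspace.generated (fun i => G.u i 0) G.isSphere_firstColumn

/-- The relation
`∑_{j_1…j_p} ∫_G u_{i_1j_1}^{e_1} ⋯ u_{i_pj_p}^{e_p} · x_{j_1}^{e_1} ⋯ x_{j_p}^{e_p}
  = ∫_G u_{i_11}^{e_1} ⋯ u_{i_p1}^{e_p} · 1`,
as a *-polynomial (left hand side minus right hand side). -/
def haarRelation [NeZero N] (G : QuantumSubgroup.{u} N) {p : ℕ} (i : Fin p → Fin N)
    (e : Fin p → Bool) : StarPoly (Fin N) :=
  ∑ j : Fin p → Fin N, G.haar (StarPoly.eval (entries G.u) (StarPoly.word (fun k => (i k, j k)) e)) •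
      StarPoly.word j e
    - algebraMap ℂ _ (G.haar (StarPoly.eval (entries G.u) (StarPoly.word (fun k => (i k, 0)) e)))

/-- The space `S_max` obtained from the free complex sphere by imposing all the relations
`haarRelation G i e`. -/
def maxSpace [NeZero N] (G : QuantumSubgroup.{u} N) : SphereSubspace.{u} N :=
  SphereSubspace.cutOut {f | ∃ (p : ℕ) (i : Fin p → Fin N) (e : Fin p → Bool),
    f = G.haarRelation i e}

end QuantumSubgroup

/-! ### Noncommutative geometries -/

/-- The coordinate functions of the real sphere `S^{N-1}_ℝ`. -/
def realSphereCoord (N : ℕ) (i : Fin N) :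
    C(Metric.sphere (0 : EuclideanSpace ℝ (Fin N)) 1, ℂ) :=
  ⟨fun p => ((p : EuclideanSpace ℝ (Fin N)) i : ℂ), by fun_prop⟩

/-- The coordinate functions `ε ↦ ε_i / √N` of the cube `ℤ₂^N`, as a subspace of the sphere. -/
def cubeCoord (N : ℕ) (i : Fin N) : (Fin N → ℤˣ) → ℂ :=
  fun ε => ((ε i : ℤ) : ℂ) / (Real.sqrt N : ℂ)

/-- `T` is the standard torus of `S`: `C(T)` is the quotient of `C(S)` by the closed two-sided ideal
generated by the relations `x_i x_i* = x_i* x_i = 1/N`. -/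
def IsStandardTorus {N : ℕ} (S T : SphereSubspace.{u} N) : Prop :=
  ∃ π : S.carrier →⋆ₐ[ℂ] T.carrier, Function.Surjective π ∧ (∀ i, π (S.x i) = T.x i) ∧
    {a | π a = 0} = closure (TwoSidedIdeal.span
      ((Set.range fun i => S.x i * star (S.x i) - algebraMap ℂ S.carrier (1 / N)) ∪
        Set.range fun i => star (S.x i) * S.x i - algebraMap ℂ S.carrier (1 / N)) :
        Set S.carrier)

/-- A noncommutative geometry `(S, T, K, G)`. The torus `T` is viewed as a subspace of the free
complex sphere, its coordinates as a subspace of the dual of the free group `F_N` being the rescaled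
elements `√N x_i`. Full and reduced quantum group algebras are identified. -/
structure NoncommutativeGeometry (N : ℕ) : Type (u + 1) where
  /-- The sphere. -/
  S : SphereSubspace.{u} N
  /-- The torus. -/
  T : SphereSubspace.{u} N
  /-- The quantum reflection group. -/
  K : QuantumSubgroup.{u} N
  /-- The unitary quantum group. -/
  G : QuantumSubgroup.{u} N
  /-- `S` is an algebraic manifold. -/
  S_algebraic : S.IsAlgebraic
  /-- `S^{N-1}_ℝ ⊂ S`. -/
  realSphere_incl : CoordIncl (realSphereCoord N) S.x
  /-- `ℤ₂^N ⊂ T`. -/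
  cube_incl : CoordIncl (cubeCoord N) T.x
  /-- `T` is contained in the dual of `F_N`: the rescaled coordinates `√N x_i` are unitaries. -/
  torus_unitary : ∀ i, (Real.sqrt N : ℂ) • T.x i ∈ unitary T.carrier
  /-- `H_N ⊂ K`. -/
  hyperoctahedral_incl : K.relations ⊆ StarPoly.relations (entries (hyperoctahedralCoord N))
  /-- `K ⊂ K_N^+`. -/
  K_reflection : IsReflectionMatrix K.u
  /-- `O_N ⊂ G`. -/
  orthogonal_incl : G.relations ⊆ StarPoly.relations (entries (orthogonalCoord N))
  /-- `K = G ∩ K_N^+`. -/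
  K_eq : K.IsReflectionPart G
  /-- `G = <K, O_N>`. -/
  G_eq : G.IsGeneratedByOrthogonal K
  /-- `T` is the standard torus of `S`. -/
  T_standard : IsStandardTorus S T
  /-- `T` is the diagonal torus of `K`. -/
  T_diag_K : K.IsDiagonalTorus T
  /-- `T` is the diagonal torus of `G`. -/
  T_diag_G : G.IsDiagonalTorus T
  /-- `G = G^+(S)`. -/
  G_isometry : G.IsQuantumIsometryGroup S
  /-- `K = G ∩ G^+(T)`. -/
  K_isometry : ∃ Q : QuantumSubgroup.{u} N, Q.IsQuantumIsometryGroup T ∧ K.IsInter G Q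

/-- Ergodicity of `(S, T, K, G)`: with `Φ : C(S) → C(G) ⊗ C(S)` the coaction and `I = ∫_G ⊗ id` the
slice map, we have `(∫_G ⊗ id) Φ = ∫_G α(·) 1`, where `α : C(S) → C(G)` is the canonical map, given
by `x_i ↦ u_{i1}`. -/
def NoncommutativeGeometry.IsErgodic {N : ℕ} [NeZero N] (g : NoncommutativeGeometry.{u} N) : Prop :=
  ∃ (T : CStarTensor g.G.carrier g.S.carrier) (Φ : g.S.carrier →⋆ₐ[ℂ] T.carrier)
    (I : T.carrier →L[ℂ] g.S.carrier), g.G.IsCoaction g.S T Φ ∧ T.IsLeftSlice g.G.haar I ∧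
    ∀ α : g.S.carrier →⋆ₐ[ℂ] g.G.carrier, (∀ i, α (g.S.x i) = g.G.u i 0) →
      ∀ f, I (Φ f) = g.G.haar (α f) • 1

end NCG

end

open scoped TensorProduct

noncomputable section

namespace NCG

namespace StarPoly

variable {ι : Type}

/-! Both inclusions come from looking at the coaction `Φ` on *-polynomials in the coordinates, where
it takes values in the algebraic tensor product. For `S_min ⊂ S`, the point `(1, 0, …, 0)` of the
real sphere gives a character `ε` of `C(S)`, and `(id ⊗ ε)Φ` sends `x_i` to `u_{i1}`. Hence the
first column of `G` satisfies every *-polynomial relation valid in `C(S)`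
(`IsCoaction.relations_subset`). Since `S` is algebraic, `C(S)` is universal for such relations,
which yields the morphism onto the first column (`IsCoaction.firstColumnSpace_le`). For `S ⊂ S_max`,
expand `Φ` of a monomial by `eval_word_sum_tmul` and apply `∫_G ⊗ id`: the result is the left side
of a defining relation of `S_max`, and ergodicity identifies it with the right side
(`IsCoaction.le_maxSpace`). The map `α` needed in the ergodicity formula is supplied by the first
inclusion. -/

lemma eval_word {A : Type*} [Ring A] [Algebra ℂ A] [Star A] (x : ι → A) {p : ℕ}
    (i : Fin p → ι) (e : Fin p → Bool) :
    eval x (word i e) = (List.ofFn fun k => colored (e k) (x (i k))).prod := by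
  rw [word, map_list_prod, List.map_ofFn]
  congr 2
  funext k
  simp [eval]

/-- Expansion of a monomial in the elements `∑ⱼ a i j ⊗ x j`. -/
lemma eval_word_sum_tmul {N : ℕ} {A B : Type*} [Ring A] [Algebra ℂ A] [StarRing A] [StarModule ℂ A]
    [Ring B] [Algebra ℂ B] [StarRing B] [StarModule ℂ B]
    (a : Matrix (Fin N) (Fin N) A) (x : Fin N → B) {p : ℕ}
    (i : Fin p → Fin N) (e : Fin p → Bool) :
    eval (fun i => ∑ j, a i j ⊗ₜ[ℂ] x j) (word i e) =
      ∑ j : Fin p → Fin N, eval (entries a) (word (fun k => (i k, j k)) e) ⊗ₜ[ℂ]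
        eval x (word j e) := by
  simp only [eval_word]
  induction p with
  | zero => simp [Algebra.TensorProduct.one_def]
  | succ p ih =>
    -- The involution of the tensor product acts factorwise, without a flip, so the exponent passes
    -- to both factors.
    have h : colored (e 0) (∑ j, a (i 0) j ⊗ₜ[ℂ] x j) =
        ∑ j, colored (e 0) (a (i 0) j) ⊗ₜ[ℂ] colored (e 0) (x j) := by
      cases e 0 <;> simp [colored]
    -- Splitting off the first letter leaves a product of two sums; `Fin.consEquiv` recombines the
    -- head index and the tail multi-index into one multi-index of length `p + 1`.
    rw [List.ofFn_succ, List.prod_cons, ih (fun k => i k.succ) (fun k => e k.succ), h,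
      Finset.sum_mul_sum, ← Finset.sum_product',
      ← (Fin.consEquiv fun _ => Fin N).sum_comp]
    refine Finset.sum_congr rfl fun q _ => ?_
    simp [List.ofFn_succ, entries, Fin.consEquiv]

end StarPoly

/-- Evaluation at the first basis vector, a point of the real sphere. -/
lemma exists_character_of_realSphere_incl {N : ℕ} [NeZero N] {S : SphereSubspace.{u} N}
    (h : CoordIncl (realSphereCoord N) S.x) :
    ∃ ε : S.carrier →⋆ₐ[ℂ] ℂ, ∀ i, ε (S.x i) = if i = 0 then 1 else 0 := by
  obtain ⟨φ, hφ⟩ := h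
  -- At this point only the coordinate `x_0` survives, which is what singles out column `0` in `∑ⱼ u
  -- i j ⊗ x j`.
  let p : Metric.sphere (0 : EuclideanSpace ℝ (Fin N)) 1 :=
    ⟨EuclideanSpace.single 0 1, by simp⟩
  refine ⟨(ContinuousMap.evalStarAlgHom ℂ ℂ p).comp φ, fun i => ?_⟩
  rw [StarAlgHom.comp_apply, hφ]
  by_cases h : i = 0 <;> simp [realSphereCoord, p, h]

namespace QuantumSubgroup

variable {N : ℕ} {G : QuantumSubgroup.{u} N} {X : SphereSubspace.{u} N}
  {T : CStarTensor G.carrier X.carrier} {Φ : X.carrier →⋆ₐ[ℂ] T.carrier}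

/-- A *-homomorphism commutes with evaluation, so knowing `Φ` on coordinates is enough. The point is
that the value lies in the image of the algebraic tensor product, so later arguments need no
extension of maps to the completion. -/
lemma IsCoaction.apply_eval (h : G.IsCoaction X T Φ) (f : StarPoly (Fin N)) :
    Φ (StarPoly.eval X.x f) =
      T.incl (StarPoly.eval (fun i => ∑ j, G.u i j ⊗ₜ[ℂ] X.x j) f) := by
  rw [StarPoly.map_eval, StarPoly.map_eval]
  exact congrArg (fun y => StarPoly.eval y f) (funext h)

/-- Relations satisfied on a space containing the real sphere, on which `G` acts, are satisfied by
the first column of `G`. -/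
lemma IsCoaction.relations_subset [NeZero N] (h : G.IsCoaction X T Φ)
    (hX : CoordIncl (realSphereCoord N) X.x) :
    StarPoly.relations X.x ⊆ StarPoly.relations fun i => G.u i 0 := by
  obtain ⟨ε, hε⟩ := exists_character_of_realSphere_incl hX
  intro f hf
  -- Injectivity of `T.incl` brings the relation down from the C*-completion to the algebraic tensor
  -- product.
  have h0 : StarPoly.eval (fun i => ∑ j, G.u i j ⊗ₜ[ℂ] X.x j) f = 0 := by
    apply T.injective
    rw [← h.apply_eval, show StarPoly.eval X.x f = 0 from hf, map_zero, map_zero]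
  -- This is `id ⊗ ε`, defined only algebraically; the two images commute because scalars are
  -- central. As `ψ` is only an algebra map, both exponents are checked below, the starred one using
  -- that `ε` preserves the star.
  let ψ : G.carrier ⊗[ℂ] X.carrier →ₐ[ℂ] G.carrier :=
    Algebra.TensorProduct.lift (AlgHom.id ℂ _)
      ((Algebra.ofId ℂ G.carrier).comp (ε : X.carrier →ₐ[ℂ] ℂ)) fun a b => (Algebra.commutes (ε b) a).symm
  have hψ (a : G.carrier) (b : X.carrier) : ψ (a ⊗ₜ b) = ε b • a := by
    rw [Algebra.smul_def, Algebra.commutes]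
    exact Algebra.TensorProduct.lift_tmul _ _ _ a b
  have hcomp : ψ.comp (StarPoly.eval fun i => ∑ j, G.u i j ⊗ₜ[ℂ] X.x j) =
      StarPoly.eval fun i => G.u i 0 := by
    apply FreeAlgebra.hom_ext
    funext ⟨i, e⟩
    cases e <;> simp [StarPoly.eval, colored, hψ, hε, map_star]
  change StarPoly.eval (fun i => G.u i 0) f = 0
  rw [← hcomp, AlgHom.comp_apply, h0, map_zero]

/-- The first column space is contained in every algebraic manifold containing the real sphere, on
which `G` acts. -/
lemma IsCoaction.firstColumnSpace_le [NeZero N] (h : G.IsCoaction X T Φ)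
    (hX : CoordIncl (realSphereCoord N) X.x) (halg : X.IsAlgebraic) :
    G.firstColumnSpace ≤ X := by
  -- `χ` shows that `R` holds on `X`; `θ` maps `C(X)` back to the universal algebra of `R`, so a
  -- morphism out of the latter is enough.
  obtain ⟨R, ⟨χ, hχ⟩, ⟨θ, hθ⟩⟩ := halg
  have hR : R ⊆ StarPoly.relations X.x := fun f hf => by
    change StarPoly.eval X.x f = 0
    rw [← funext hχ, ← StarPoly.map_eval,
      show StarPoly.eval (SphereSubspace.cutOut R).x f = 0 from SphereSubspace.cutOut_relations R hf, map_zero]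
  let ι : G.firstColumnSpace.carrier →⋆ₐ[ℂ] G.carrier := StarSubalgebra.subtype
    (StarAlgebra.adjoin ℂ (Set.range fun i => G.u i 0)).topologicalClosure
  obtain ⟨φ, hφ⟩ := SphereSubspace.exists_hom_cutOut R G.firstColumnSpace.x
    G.firstColumnSpace.sphere fun f hf => by
      apply Subtype.val_injective
      exact (StarPoly.map_eval ι G.firstColumnSpace.x f).trans (h.relations_subset hX (hR hf))
  exact ⟨φ.comp θ, fun i => by rw [StarAlgHom.comp_apply, hθ, hφ]⟩

/-- A space satisfying the ergodicity formula on monomials satisfies the relations of `S_max`. -/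
lemma IsCoaction.le_maxSpace [NeZero N] (h : G.IsCoaction X T Φ)
    {I : T.carrier →L[ℂ] X.carrier} (hI : T.IsLeftSlice G.haar I)
    (herg : ∀ f, I (Φ (StarPoly.eval X.x f)) =
      G.haar (StarPoly.eval (fun i => G.u i 0) f) • 1) :
    X ≤ G.maxSpace := by
  refine SphereSubspace.exists_hom_cutOut _ X.x X.sphere ?_
  rintro _ ⟨p, i, e, rfl⟩
  have h1 := herg (StarPoly.word i e)
  rw [h.apply_eval, StarPoly.eval_word_sum_tmul] at h1
  -- After the expansion only finite sums of elementary tensors occur, exactly where the slice map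
  -- is prescribed.
  simp only [map_sum, hI _ _] at h1
  change StarPoly.eval X.x (G.haarRelation i e) = 0
  rw [haarRelation, map_sub, map_sum, AlgHom.commutes, Algebra.algebraMap_eq_smul_one, sub_eq_zero]
  simp only [map_smul, h1]
  -- What remains is to match two readings of one product: a word in the entries `(i k, 0)` and a
  -- word in the first column.
  simp only [StarPoly.eval_word, entries]

end QuantumSubgroup

end NCG

end

theorem theorem4p5 {N : ℕ} [NeZero N] (g : NCG.NoncommutativeGeometry.{u} N)
    (hg : g.IsErgodic) :
    g.G.firstColumnSpace ≤ g.S ∧ g.S ≤ g.G.maxSpace := by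
  obtain ⟨T, Φ, I, hΦ, hI, herg⟩ := hg
  have hmin := hΦ.firstColumnSpace_le g.realSphere_incl g.S_algebraic
  refine ⟨hmin, hΦ.le_maxSpace hI fun f => ?_⟩
  -- Ergodicity is quantified over all candidates for `α`, so it says nothing until one exists: take
  -- `φ` followed by the inclusion into `C(G)`.
  obtain ⟨φ, hφ⟩ := hmin
  let ι : g.G.firstColumnSpace.carrier →⋆ₐ[ℂ] g.G.carrier := StarSubalgebra.subtype
    (StarAlgebra.adjoin ℂ (Set.range fun i => g.G.u i 0)).topologicalClosure
  have hα (i : Fin N) : (ι.comp φ) (g.S.x i) = g.G.u i 0 := congrArg ι (hφ i)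
  rw [herg _ hα, NCG.StarPoly.map_eval, funext hα]
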